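/- Let $K$ be an infinite field, $\Gamma$ a finite quiver, and $\Lambda=K\Gamma/I$, where $K\Gamma$ is the path algebra and $I$ is an admissible ideal (a two-sided ideal with $A^N\subseteq I\subseteq A^2$ for some $N\ge 2$, where $A$ is the ideal of $K\Gamma$ generated by the arrows). Paths are composed so that $qp$ means "$q$ after $p$". A path $u$ is a subpath of a path $p$ if $p=u'uu''$ for some (possibly trivial) paths $u',u''$. A path $p$ of length $l$ in $K\Gamma$ is called a mast of a left $\Lambda$-module $U$ if $U$ is uniserial (its submodules form a chain), has composition length $l+1$, and $pU\neq 0$; a mast is a path that is a mast of some uniserial left $\Lambda$-module. Proposition 3.2. Let $\alpha:e\to e'$ be an arrow of $\Gamma$ (the vertices $e$ and $e'$ may coincide), and let $p:e\to e'$ be a mast of positive length that neither starts in $\alpha$ nor ends in $\alpha$; that is, $p\ne p'\alpha$ for every path $p':e'\to e'$ and $p\ne\alpha p'$ for every path $p':e\to e$. Then there exists a subpath $q$ of $p$ such that there are infinitely many pairwise non-isomorphic uniserial left $\Lambda$-modules with mast $q$. -/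

import Mathlib

universe u v w x

open Quiver

/-- All paths of the quiver `V`, each bundled with its initial and terminal vertex. -/
abbrev TotalPath (V : Type u) [Quiver.{v} V] : Type (max u v) :=
  Σ a : V, Σ b : V, Path a b

/-- The path algebra of the quiver `V` over `K`: the `K`-vector space with basis all paths of the
quiver, including the trivial path at each vertex. Its product is defined below; it is not
the pointwise product of coefficient functions. -/
def PathAlgebra (K : Type w) [Field K] (V : Type u) [Quiver.{v} V] : Type (max u v w) :=
  TotalPath V →₀ K

namespace PathAlgebra

variable (K : Type w) [Field K] {V : Type u} [Quiver.{v} V]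

noncomputable instance : AddCommGroup (PathAlgebra K V) :=
  inferInstanceAs (AddCommGroup (TotalPath V →₀ K))

noncomputable instance : Module K (PathAlgebra K V) :=
  inferInstanceAs (Module K (TotalPath V →₀ K))

/-- The path `p` as an element of the path algebra. -/
noncomputable def ofPath {a b : V} (p : Path a b) : PathAlgebra K V :=
  Finsupp.single (⟨a, b, p⟩ : TotalPath V) (1 : K)

/-- The coefficient of the path `p` in the element `f` of the path algebra. -/
def coeff {K : Type w} [Field K] (f : PathAlgebra K V) {a b : V} (p : Path a b) : K :=
  (show TotalPath V →₀ K from f) ⟨a, b, p⟩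

open Classical in
/-- The product `q p` (`q` after `p`) of two paths: their concatenation if `p` ends where `q`
starts, and `0` otherwise. (`Path.comp` lists its arguments in order of traversal.) -/
noncomputable def pathMul (q p : TotalPath V) : PathAlgebra K V :=
  if h : p.2.1 = q.1 then ofPath K ((p.2.2.cast rfl h).comp q.2.2) else 0

/-- The `K`-bilinear extension of the product of paths. -/
noncomputable def mulBilin : PathAlgebra K V →ₗ[K] PathAlgebra K V →ₗ[K] PathAlgebra K V :=
  Finsupp.linearCombination K fun q : TotalPath V =>
    (Finsupp.linearCombination K fun p : TotalPath V => pathMul K q p :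
      (TotalPath V →₀ K) →ₗ[K] PathAlgebra K V)

noncomputable instance : Mul (PathAlgebra K V) := ⟨fun f g => mulBilin K f g⟩

noncomputable instance [Fintype V] : One (PathAlgebra K V) :=
  ⟨∑ e : V, ofPath K (Path.nil : Path e e)⟩

variable {K}

theorem mul_def (f g : PathAlgebra K V) : f * g = mulBilin K f g := rfl

theorem one_def [Fintype V] :
    (1 : PathAlgebra K V) = ∑ e : V, ofPath K (Path.nil : Path e e) := rfl

theorem induction_on {P : PathAlgebra K V → Prop} (f : PathAlgebra K V) (h0 : P 0)
    (hadd : ∀ f g, P f → P g → P (f + g))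
    (hpath : ∀ (c : K) (a b : V) (p : Path a b), P (c • ofPath K p)) : P f := by
  refine Finsupp.induction_linear (motive := P) f h0 hadd ?_
  rintro ⟨a, b, p⟩ c
  have h := hpath c a b p
  have e : c • ofPath K p = (Finsupp.single (⟨a, b, p⟩ : TotalPath V) c : TotalPath V →₀ K) := by
    change c • (Finsupp.single (⟨a, b, p⟩ : TotalPath V) (1 : K)) = _
    rw [Finsupp.smul_single, smul_eq_mul, mul_one]
  exact e ▸ h

theorem mulBilin_ofPath {a b c d : V} (q : Path c d) (p : Path a b) :
    mulBilin K (ofPath K q) (ofPath K p) = pathMul K ⟨c, d, q⟩ ⟨a, b, p⟩ := by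
  unfold mulBilin ofPath
  erw [Finsupp.linearCombination_single, one_smul, Finsupp.linearCombination_single, one_smul]

theorem ofPath_mul_ofPath {a b d : V} (q : Path b d) (p : Path a b) :
    ofPath K q * ofPath K p = ofPath K (p.comp q) := by
  rw [mul_def, mulBilin_ofPath, pathMul, dif_pos rfl]; rfl

theorem ofPath_mul_ofPath_of_ne {a b c d : V} (q : Path c d) (p : Path a b) (h : b ≠ c) :
    ofPath K q * ofPath K p = 0 := by
  rw [mul_def, mulBilin_ofPath, pathMul, dif_neg h]

theorem zmul (f : PathAlgebra K V) : 0 * f = 0 := by simp [mul_def]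
theorem mulz (f : PathAlgebra K V) : f * 0 = 0 := by simp [mul_def]
theorem addmul (f g h : PathAlgebra K V) : (f + g) * h = f * h + g * h := by
  simp [mul_def]
theorem muladd (f g h : PathAlgebra K V) : f * (g + h) = f * g + f * h := by
  simp [mul_def]
theorem smulmul (c : K) (f g : PathAlgebra K V) : (c • f) * g = c • (f * g) := by
  simp [mul_def]
theorem mulsmul (c : K) (f g : PathAlgebra K V) : f * (c • g) = c • (f * g) := by
  simp [mul_def]

theorem ofPath_assoc {a b c d e f : V} (r : Path e f) (q : Path c d) (p : Path a b) :
    ofPath K r * ofPath K q * ofPath K p = ofPath K r * (ofPath K q * ofPath K p) := by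
  by_cases h1 : d = e
  · subst h1
    by_cases h2 : b = c
    · subst h2
      simp only [ofPath_mul_ofPath, Path.comp_assoc]
    · rw [ofPath_mul_ofPath, ofPath_mul_ofPath_of_ne _ _ h2, ofPath_mul_ofPath_of_ne _ _ h2, mulz]
  · by_cases h2 : b = c
    · subst h2
      rw [ofPath_mul_ofPath, ofPath_mul_ofPath_of_ne _ _ h1, ofPath_mul_ofPath_of_ne _ _ h1, zmul]
    · rw [ofPath_mul_ofPath_of_ne _ _ h1, ofPath_mul_ofPath_of_ne _ _ h2, zmul, mulz]

theorem mulassoc (f g h : PathAlgebra K V) : f * g * h = f * (g * h) := by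
  induction f using induction_on with
  | h0 => simp only [zmul]
  | hadd f₁ f₂ h1 h2 => simp only [addmul, h1, h2]
  | hpath c a b r =>
    induction g using induction_on with
    | h0 => simp only [zmul, mulz]
    | hadd f₁ f₂ h1 h2 => simp only [addmul, muladd, h1, h2]
    | hpath c' a' b' q =>
      induction h using induction_on with
      | h0 => simp only [mulz]
      | hadd f₁ f₂ h1 h2 => simp only [muladd, h1, h2]
      | hpath c'' a'' b'' p => simp only [smulmul, mulsmul, ofPath_assoc]

theorem onemul [Fintype V] (f : PathAlgebra K V) : 1 * f = f := by
  induction f using induction_on with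
  | h0 => exact mulz _
  | hadd f₁ f₂ h1 h2 => rw [muladd, h1, h2]
  | hpath c a b p =>
    rw [mulsmul, one_def, mul_def, map_sum, LinearMap.sum_apply]
    rw [Finset.sum_eq_single b]
    · rw [← mul_def, ofPath_mul_ofPath, Path.comp_nil]
    · intro e _ he
      rw [← mul_def, ofPath_mul_ofPath_of_ne _ _ he.symm]
    · intro h; exact absurd (Finset.mem_univ _) h

theorem mulone [Fintype V] (f : PathAlgebra K V) : f * 1 = f := by
  induction f using induction_on with
  | h0 => exact zmul _
  | hadd f₁ f₂ h1 h2 => rw [addmul, h1, h2]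
  | hpath c a b p =>
    rw [smulmul, one_def, mul_def, map_sum]
    rw [Finset.sum_eq_single a]
    · rw [← mul_def, ofPath_mul_ofPath, Path.nil_comp]
    · intro e _ he
      rw [← mul_def, ofPath_mul_ofPath_of_ne _ _ he]
    · intro h; exact absurd (Finset.mem_univ _) h

noncomputable instance [Fintype V] : Ring (PathAlgebra K V) :=
  { (inferInstance : AddCommGroup (PathAlgebra K V)),
    (inferInstance : Mul (PathAlgebra K V)),
    (inferInstance : One (PathAlgebra K V)) with
    zero_mul := zmul
    mul_zero := mulz
    left_distrib := muladd
    right_distrib := addmul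
    mul_assoc := mulassoc
    one_mul := onemul
    mul_one := mulone }

noncomputable instance [Fintype V] : Algebra K (PathAlgebra K V) :=
  Algebra.ofModule smulmul mulsmul

variable [Fintype V]

/-- An ideal `I` of the path algebra is admissible if it lies between some power of the
ideal generated by the arrows and the square of that ideal. (The `n`-th power of the arrow ideal
is the span of all paths of length at least `n`.) -/
def IsAdmissible (I : Ideal (PathAlgebra K V)) : Prop :=
  (∃ N : ℕ, 2 ≤ N ∧ ∀ (a b : V) (p : Path a b), N ≤ p.length → ofPath K p ∈ I) ∧
    ∀ f ∈ I, ∀ (a b : V) (p : Path a b), coeff f p ≠ 0 → 2 ≤ p.length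

/-- The path `p` is a mast of the uniserial left module `U` over the algebra `KΓ / I`: the
submodules of `U` form a chain, `U` has (finite) composition length `l + 1`, where `l` is the
length of `p`, and `p U ≠ 0`. -/
def IsMast (I : Ideal (PathAlgebra K V)) [I.IsTwoSided] {a b : V} (p : Path a b)
    (U : Type x) [AddCommGroup U] [Module (PathAlgebra K V ⧸ I) U] : Prop :=
  (∀ M N : Submodule (PathAlgebra K V ⧸ I) U, M ≤ N ∨ N ≤ M) ∧
    Module.length (PathAlgebra K V ⧸ I) U = p.length + 1 ∧
    ∃ y : U, Ideal.Quotient.mk I (ofPath K p) • y ≠ 0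

end PathAlgebra

/-- `q` is a subpath of `p`: `p` traverses some path, then `q`, then some path. -/
def IsSubpath {V : Type u} [Quiver.{v} V] {a b e e' : V} (q : Path a b) (p : Path e e') :
    Prop :=
  ∃ (r : Path e a) (s : Path b e'), p = (r.comp q).comp s

/-! ### Two factorizations of the same path -/

namespace Quiver.Path

variable {V : Type u} [Quiver.{v} V]

/-! Let `p` have length `n` and be a mast of `U`, with `y` in `U` fixed by the trivial path at `e`
and `p y ≠ 0`. The images `xᵢ` of `y` under the initial subpaths of `p` form a `K`-basis of `U` in
which arrows are strictly lower triangular (`IsMast.exists_isMastRep`); conversely such matrices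
define a module with mast `p` (`IsMastRep.isMast`).

Now add `k xₙ` to `α x₀`, for `k` in `K`. This is again a representation, since taking the
coefficient of `α` is a derivation that vanishes on `I ⊆ A²`; it keeps the mast, since `p` does not
start in `α` (`exists_deform`).

To tell the deformations apart, replace `p` by a shortest subpath `e → e'` of positive length that
neither starts nor ends in `α`; it is the mast of a subquotient (`exists_subpath`). By minimality,
`p` leaves each inner passage through `e` by `α` and enters each inner passage through `e'` by `α`.
The second fact lets the generator be changed until `α x₀ = d p x₀` (`exists_mulVec_eq`); the first
makes the scalar in such a relation independent of the generator (`eq_apply_last_of_mulVec_eq`). The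
deformed scalars `d + k` are therefore isomorphism invariants, and `K` is infinite. -/

theorem exists_comp_of_comp_eq_comp {a b c : V} (r : Path a c) {d : V} (r' : Path a d)
    (s : Path c b) (s' : Path d b) (h : r.comp s = r'.comp s') (hl : r.length ≤ r'.length) :
    ∃ t : Path c d, r' = r.comp t ∧ s = t.comp s' := by
  induction s' with
  | nil => exact ⟨s, h.symm, rfl⟩
  | cons s' β ih =>
    cases s with
    | nil =>
      have := congrArg length h
      simp only [length_comp, length_nil, length_cons] at this
      omega
    | cons s γ =>
      simp only [comp_cons] at h
      obtain rfl := obj_eq_of_cons_eq_cons h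
      obtain ⟨t, h1, rfl⟩ := ih s (eq_of_heq (heq_of_cons_eq_cons h))
      obtain rfl := eq_of_heq (hom_heq_of_cons_eq_cons h)
      exact ⟨t, h1, rfl⟩

end Quiver.Path

/-! ### Coefficient functionals -/

namespace PathAlgebra

variable {K : Type w} [Field K] {V : Type u} [Quiver.{v} V]

theorem coeff_add (f g : PathAlgebra K V) {a b : V} (p : Path a b) :
    coeff (f + g) p = coeff f p + coeff g p := Finsupp.add_apply ..

theorem coeff_smul (c : K) (f : PathAlgebra K V) {a b : V} (p : Path a b) :
    coeff (c • f) p = c * coeff f p := Finsupp.smul_apply ..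

theorem coeff_zero {a b : V} (p : Path a b) : coeff (0 : PathAlgebra K V) p = 0 := rfl

open Classical in
theorem coeff_ofPath {a b c d : V} (q : Path c d) (p : Path a b) :
    coeff (ofPath K q) p =
      if (⟨c, d, q⟩ : TotalPath V) = ⟨a, b, p⟩ then 1 else 0 := by
  unfold coeff ofPath
  exact Finsupp.single_apply

theorem coeff_ofPath_self {a b : V} (p : Path a b) : coeff (ofPath K p) p = 1 := by
  rw [coeff_ofPath, if_pos rfl]

theorem coeff_ofPath_of_length_ne {a b c d : V} (q : Path c d) (p : Path a b)
    (h : q.length ≠ p.length) : coeff (ofPath K q) p = 0 := by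
  rw [coeff_ofPath, if_neg]
  intro e
  cases e
  exact h rfl

theorem coeff_ofPath_nil_of_ne {a b : V} (h : a ≠ b) :
    coeff (ofPath K (Path.nil : Path a a)) (Path.nil : Path b b) = 0 := by
  rw [coeff_ofPath, if_neg]
  intro e
  cases e
  exact h rfl

theorem coeff_one [Fintype V] {a b : V} (p : Path a b) (hp : 0 < p.length) :
    coeff (1 : PathAlgebra K V) p = 0 := by
  have : ∀ s : Finset V, coeff (∑ e ∈ s, ofPath K (Path.nil : Path e e)) p = 0 := by
    classical
    intro s
    induction s using Finset.induction_on with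
    | empty => exact coeff_zero p
    | insert a s ha ih =>
      rw [Finset.sum_insert ha, coeff_add, ih, coeff_ofPath_of_length_ne, add_zero]
      simp only [Path.length_nil]; omega
  exact this _

/-- Taking the coefficient of an arrow is a derivation from the path algebra to its bimodule of
scalars, acting through the trivial paths at the ends of the arrow. -/
theorem coeff_mul_toPath [Fintype V] {e e' : V} (α : e ⟶ e') (f g : PathAlgebra K V) :
    coeff (f * g) α.toPath = coeff f α.toPath * coeff g (Path.nil : Path e e) +
      coeff f (Path.nil : Path e' e') * coeff g α.toPath := by
  induction f using induction_on with
  | h0 => simp [coeff_zero]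
  | hadd f₁ f₂ h1 h2 => rw [add_mul, coeff_add, h1, h2, coeff_add, coeff_add]; ring
  | hpath c c₁ c₂ q =>
    induction g using induction_on with
    | h0 => simp [coeff_zero]
    | hadd f₁ f₂ h1 h2 => rw [mul_add, coeff_add, h1, h2, coeff_add, coeff_add]; ring
    | hpath d d₁ d₂ r =>
      rw [show (c • ofPath K q) * (d • ofPath K r) = (c * d) • (ofPath K q * ofPath K r) by
        rw [mul_smul]; exact (smulmul _ _ _).trans (congrArg _ (mulsmul _ _ _))]
      simp only [coeff_smul]
      suffices h : coeff (ofPath K q * ofPath K r) α.toPath =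
          coeff (ofPath K q) α.toPath * coeff (ofPath K r) (Path.nil : Path e e) +
            coeff (ofPath K q) (Path.nil : Path e' e') * coeff (ofPath K r) α.toPath by
        rw [h]; ring
      by_cases hd : d₂ = c₁
      · subst hd
        rw [ofPath_mul_ofPath]
        -- A single arrow factors only as itself times a trivial path, on either side.
        cases q with
        | nil =>
          rw [Path.comp_nil, coeff_ofPath_of_length_ne Path.nil α.toPath (by simp), zero_mul,
            zero_add]
          by_cases h : c₂ = e'
          · subst h; rw [coeff_ofPath_self, one_mul]
          · rw [coeff_ofPath_nil_of_ne h, zero_mul, coeff_ofPath, if_neg]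
            intro h'; cases h'; exact h rfl
        | cons q β =>
          rw [coeff_ofPath_of_length_ne (q.cons β) (Path.nil : Path e' e') (by simp), zero_mul,
            add_zero]
          cases r with
          | nil =>
            rw [Path.nil_comp]
            by_cases h : d₁ = e
            · subst h; rw [coeff_ofPath_self, mul_one]
            · rw [coeff_ofPath_nil_of_ne h, mul_zero, coeff_ofPath, if_neg]
              intro h'; cases h'; exact h rfl
          | cons r γ =>
            rw [coeff_ofPath_of_length_ne, coeff_ofPath_of_length_ne (r.cons γ), mul_zero]
            · simp
            · simp [Path.length_comp]
      · rw [ofPath_mul_ofPath_of_ne _ _ hd, coeff_zero]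
        have h1 : coeff (ofPath K q) α.toPath * coeff (ofPath K r) (Path.nil : Path e e) = 0 := by
          rw [coeff_ofPath, coeff_ofPath]
          split_ifs with h1 h2
          · cases h1; cases h2; exact absurd rfl hd
          all_goals simp
        have h2 : coeff (ofPath K q) (Path.nil : Path e' e') * coeff (ofPath K r) α.toPath = 0 := by
          rw [coeff_ofPath, coeff_ofPath]
          split_ifs with h1 h2
          · injection h1 with h1 h1'
            injection h2 with h2 h2'
            subst h1 h2
            cases h2'
            exact absurd rfl hd
          all_goals simp
        rw [h1, h2, add_zero]

/-! ### Matrix representations along a mast, and their deformation -/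

variable [Fintype V]

/-- A matrix representation of `KΓ / I` on the space with basis `x₀, …, xₙ` in which every
arrow is strictly lower triangular and `xᵢ` is the image of `x₀` under the initial subpath of
length `i` of the path `p` of length `n`. -/
structure IsMastRep (I : Ideal (PathAlgebra K V)) {a b : V} (p : Path a b)
    (ρ : PathAlgebra K V →ₐ[K] Matrix (Fin (p.length + 1)) (Fin (p.length + 1)) K) : Prop where
  ann : ∀ f ∈ I, ρ f = 0
  tri : ∀ (c d : V) (β : c ⟶ d) i j, i ≤ j → ρ (ofPath K β.toPath) i j = 0
  pre : ∀ (c : V) (r : Path a c) (s : Path c b), p = r.comp s →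
    ∀ i, ρ (ofPath K r) i 0 = if (i : ℕ) = r.length then 1 else 0

namespace IsMastRep

variable {I : Ideal (PathAlgebra K V)} {a b : V} {p : Path a b}
  {ρ : PathAlgebra K V →ₐ[K] Matrix (Fin (p.length + 1)) (Fin (p.length + 1)) K}

/-- Since `r` carries `x₀` to `xⱼ`, every column of `ρ f` is a zeroth column; `pre` thus governs all
positions along `p`. -/
theorem mul_apply_of_pre (h : IsMastRep I p ρ) (f : PathAlgebra K V) {c : V} (r : Path a c)
    (s : Path c b) (hp : p = r.comp s) (i j : Fin (p.length + 1)) (hj : (j : ℕ) = r.length) :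
    ρ (f * ofPath K r) i 0 = ρ f i j := by
  rw [map_mul, Matrix.mul_apply, Finset.sum_eq_single j]
  · rw [h.pre c r s hp, if_pos hj, mul_one]
  · intro k _ hk
    rw [h.pre c r s hp, if_neg, mul_zero]
    intro hk'; exact hk (Fin.ext (hk'.trans hj.symm))
  · simp

theorem subpath_apply (h : IsMastRep I p ρ) {c d : V} (r : Path a c) (t : Path c d)
    (s : Path d b) (hp : p = (r.comp t).comp s) (i j : Fin (p.length + 1))
    (hj : (j : ℕ) = r.length) :
    ρ (ofPath K t) i j = if (i : ℕ) = j + t.length then 1 else 0 := by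
  rw [← h.mul_apply_of_pre _ r (t.comp s) (by rw [hp, Path.comp_assoc]) i j hj,
    ofPath_mul_ofPath, h.pre _ _ s hp, Path.length_comp, hj]

theorem nil_apply (h : IsMastRep I p ρ) {c : V} (r : Path a c) (s : Path c b)
    (hp : p = r.comp s) (i j : Fin (p.length + 1)) (hj : (j : ℕ) = r.length) :
    ρ (ofPath K (Path.nil : Path c c)) i j = if i = j then 1 else 0 := by
  rw [h.subpath_apply r Path.nil s hp i j hj]
  simp [Fin.ext_iff]

theorem nil_apply_of_ne (h : IsMastRep I p ρ) {c : V} (r : Path a c) (s : Path c b)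
    (hp : p = r.comp s) {d : V} (hd : c ≠ d) (i j : Fin (p.length + 1))
    (hj : (j : ℕ) = r.length) :
    ρ (ofPath K (Path.nil : Path d d)) i j = 0 := by
  rw [← h.mul_apply_of_pre _ r s hp i j hj, ofPath_mul_ofPath_of_ne _ _ hd, map_zero]; rfl

theorem nil_apply_of_index_ne (h : IsMastRep I p ρ) (d : V) (i j : Fin (p.length + 1))
    (hij : i ≠ j) : ρ (ofPath K (Path.nil : Path d d)) i j = 0 := by
  obtain ⟨c, r, s, hp, hr⟩ := p.exists_eq_comp_of_le_length (Nat.lt_succ_iff.1 j.2)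
  by_cases hc : c = d
  · subst hc
    rw [h.nil_apply r s hp i j hr.symm, if_neg hij]
  · exact h.nil_apply_of_ne r s hp hc i j hr.symm

/-- Trivial paths are diagonal and each arrow pushes at least one step down. -/
theorem path_apply (h : IsMastRep I p ρ) {c d : V} (q : Path c d) (i j : Fin (p.length + 1))
    (hij : (i : ℕ) < j + q.length) : ρ (ofPath K q) i j = 0 := by
  induction q generalizing i with
  | nil => exact h.nil_apply_of_index_ne _ _ _ (by rintro rfl; simp at hij)
  | cons q β ih =>
    have : ofPath K (q.cons β) = ofPath K β.toPath * ofPath K q := by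
      rw [ofPath_mul_ofPath]; rfl
    rw [this, map_mul, Matrix.mul_apply]
    refine Finset.sum_eq_zero fun k _ => ?_
    by_cases hk : i ≤ k
    · rw [h.tri _ _ _ _ _ hk, zero_mul]
    · rw [ih k, mul_zero]
      have := Fin.lt_def.1 (not_le.1 hk)
      simp only [Path.length_cons] at hij
      omega

theorem apply_of_lt (h : IsMastRep I p ρ) (f : PathAlgebra K V) (i j : Fin (p.length + 1))
    (hij : i < j) : ρ f i j = 0 := by
  induction f using induction_on with
  | h0 => simp
  | hadd f g hf hg => rw [map_add, Matrix.add_apply, hf, hg, add_zero]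
  | hpath c a b q =>
    rw [map_smul, Matrix.smul_apply, h.path_apply q i j (by have := Fin.lt_def.1 hij; omega),
      smul_zero]

/-- With `apply_last`, this makes the matrix unit from `x₀` to the socle vector a simultaneous
eigenvector for multiplication by `ρ f` on both sides, as the deformation requires. -/
theorem zero_apply (h : IsMastRep I p ρ) (f : PathAlgebra K V) (j : Fin (p.length + 1)) :
    ρ f 0 j = if j = 0 then coeff f (Path.nil : Path a a) else 0 := by
  split_ifs with hj
  · subst hj
    induction f using induction_on with
    | h0 => simp [coeff_zero]
    | hadd f g hf hg => rw [map_add, Matrix.add_apply, hf, hg, coeff_add]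
    | hpath c d₁ d₂ q =>
      rw [map_smul, Matrix.smul_apply, coeff_smul, smul_eq_mul]
      congr 1
      cases q with
      | nil =>
        by_cases hd : a = d₁
        · subst hd
          rw [h.nil_apply Path.nil p (by simp) _ _ rfl, if_pos rfl, coeff_ofPath_self]
        · rw [h.nil_apply_of_ne Path.nil p (by simp) hd _ _ rfl,
            coeff_ofPath_nil_of_ne (Ne.symm hd)]
      | cons q β =>
        rw [h.path_apply _ _ _ (by simp), coeff_ofPath_of_length_ne _ _ (by simp)]
  · exact h.apply_of_lt f _ _ (Fin.pos_iff_ne_zero.2 hj)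

theorem apply_last (h : IsMastRep I p ρ) (f : PathAlgebra K V) (i : Fin (p.length + 1)) :
    ρ f i (Fin.last _) = if i = Fin.last _ then coeff f (Path.nil : Path b b) else 0 := by
  split_ifs with hj
  · subst hj
    induction f using induction_on with
    | h0 => simp [coeff_zero]
    | hadd f g hf hg => rw [map_add, Matrix.add_apply, hf, hg, coeff_add]
    | hpath c d₁ d₂ q =>
      rw [map_smul, Matrix.smul_apply, coeff_smul, smul_eq_mul]
      congr 1
      cases q with
      | nil =>
        by_cases hd : b = d₁
        · subst hd
          rw [h.nil_apply p Path.nil (by simp) _ _ rfl, if_pos rfl, coeff_ofPath_self]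
        · rw [h.nil_apply_of_ne p Path.nil (by simp) hd _ _ rfl,
            coeff_ofPath_nil_of_ne (Ne.symm hd)]
      | cons q β =>
        rw [h.path_apply _ _ _ (by simp), coeff_ofPath_of_length_ne _ _ (by simp)]
  · exact h.apply_of_lt f _ _ (Fin.lt_last_iff_ne_last.2 hj)

/-- A trivial path projects onto the positions where `p` visits its vertex. -/
theorem apply_eq_zero_of_nil_mulVec_eq (h : IsMastRep I p ρ) {c : V} (r : Path a c)
    (s : Path c b) (hp : p = r.comp s) {d : V} (hd : c ≠ d) (z : Fin (p.length + 1) → K)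
    (hz : (ρ (ofPath K (Path.nil : Path d d))).mulVec z = z) (j : Fin (p.length + 1))
    (hj : (j : ℕ) = r.length) : z j = 0 := by
  rw [← hz, Matrix.mulVec, dotProduct]
  refine Finset.sum_eq_zero fun k _ => ?_
  by_cases hk : j = k
  · subst hk; rw [h.nil_apply_of_ne r s hp hd _ _ hj, zero_mul]
  · rw [h.nil_apply_of_index_ne _ _ _ hk, zero_mul]

/-- The representation on the subquotient spanned by the basis vectors along a subpath. -/
theorem exists_subpath (h : IsMastRep I p ρ) {c d : V} (r : Path a c) (q : Path c d)
    (s : Path d b) (hp : p = (r.comp q).comp s) : ∃ σ, IsMastRep I q σ := by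
  have hlen : p.length = r.length + q.length + s.length := by
    rw [hp, Path.length_comp, Path.length_comp]
  let ι : Fin (q.length + 1) → Fin (p.length + 1) := fun i => ⟨r.length + i, by omega⟩
  have ι_inj : Function.Injective ι := by
    intro i j hij
    have := congrArg Fin.val hij
    simp only [ι] at this
    exact Fin.ext (by omega)
  let σ : PathAlgebra K V →ₐ[K] Matrix (Fin (q.length + 1)) (Fin (q.length + 1)) K :=
    { toFun := fun f => (ρ f).submatrix ι ι
      map_one' := by rw [map_one]; exact Matrix.submatrix_one (α := K) _ ι_inj
      map_mul' := by
        intro f g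
        ext i j
        rw [map_mul, Matrix.submatrix_apply, Matrix.mul_apply, Matrix.mul_apply]
        -- By triangularity only indices between `ι j` and `ι i` contribute to the product, and the
        -- block is an interval.
        refine (Finset.sum_of_injOn ι ι_inj.injOn (by simp) ?_ fun _ _ => rfl).symm
        intro k _ hk
        by_cases h1 : k < ι j
        · rw [h.apply_of_lt g _ _ h1, mul_zero]
        by_cases h2 : ι i < k
        · rw [h.apply_of_lt f _ _ h2, zero_mul]
        refine absurd ?_ hk
        rw [not_lt, Fin.le_def] at h1 h2
        simp only [ι] at h1 h2
        refine ⟨⟨k - r.length, by omega⟩, by simp, Fin.ext ?_⟩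
        simp only [ι]
        omega
      map_zero' := by rw [map_zero]; rfl
      map_add' := by intro f g; rw [map_add]; rfl
      commutes' := by
        intro c
        rw [AlgHom.commutes, Algebra.algebraMap_eq_smul_one, Algebra.algebraMap_eq_smul_one]
        exact congrArg (c • ·) (Matrix.submatrix_one (α := K) _ ι_inj) }
  refine ⟨σ, ?_, ?_, ?_⟩
  · intro f hf
    change (ρ f).submatrix ι ι = 0
    rw [h.ann f hf]; rfl
  · intro c d β i j hij
    refine h.tri c d β (ι i) (ι j) ?_
    rw [Fin.le_def] at hij ⊢
    simp only [ι]; omega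
  · intro c t t' hq i
    refine (h.subpath_apply r t (t'.comp s) ?_ (ι i) (ι 0) rfl).trans ?_
    · rw [hp, hq]; simp only [Path.comp_assoc]
    · simp [ι]

/-- Adding `k` times the socle basis vector to the image of `x₀` under an arrow `α` parallel to
`p`. -/
theorem exists_deform (h : IsMastRep I p ρ) (hI : IsAdmissible I) (hlen : 0 < p.length)
    (α : a ⟶ b) (hstart : ¬ ∃ p' : Path b b, p = α.toPath.comp p') (k : K) :
    ∃ σ, IsMastRep I p σ ∧ ∀ f i j, σ f i j = ρ f i j +
      if i = Fin.last _ ∧ j = 0 then k * coeff f α.toPath else 0 := by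
  let E : Matrix (Fin (p.length + 1)) (Fin (p.length + 1)) K := Matrix.single (Fin.last _) 0 1
  have hne : (0 : Fin (p.length + 1)) ≠ Fin.last _ := by
    rw [Ne, Fin.ext_iff]; simp; omega
  have hEE : E * E = 0 := Matrix.single_mul_single_of_ne _ _ _ _ hne _
  have hE_apply (i j) : E i j = if i = Fin.last _ ∧ j = 0 then 1 else 0 := by
    simp [E, Matrix.single_apply, eq_comm]
  have hE (f) : E * ρ f = coeff f (Path.nil : Path a a) • E := by
    ext i j
    rw [Matrix.smul_apply, Matrix.mul_apply, hE_apply, Finset.sum_eq_single 0, h.zero_apply,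
      hE_apply]
    · by_cases hi : i = Fin.last _ <;> by_cases hj : j = 0 <;> simp [hi, hj]
    · intro k _ hk; rw [hE_apply, if_neg (fun h' => hk h'.2), zero_mul]
    · simp
  have hE' (f) : ρ f * E = coeff f (Path.nil : Path b b) • E := by
    ext i j
    rw [Matrix.smul_apply, Matrix.mul_apply, hE_apply, Finset.sum_eq_single (Fin.last _),
      h.apply_last, hE_apply]
    · by_cases hi : i = Fin.last _ <;> by_cases hj : j = 0 <;> simp [hi, hj]
    · intro k _ hk; rw [hE_apply, if_neg (fun h' => hk h'.1), mul_zero]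
    · simp
  let σ : PathAlgebra K V →ₐ[K] Matrix (Fin (p.length + 1)) (Fin (p.length + 1)) K :=
    { toFun := fun f => ρ f + (k * coeff f α.toPath) • E
      map_one' := by rw [map_one, coeff_one _ (by simp)]; simp
      map_mul' := by
        intro f g
        -- The square term dies by `E * E = 0`, and the cross terms are exactly the derivation rule
        -- for the coefficient of `α`.
        simp only [map_mul, coeff_mul_toPath, add_mul, mul_add, Matrix.smul_mul, Matrix.mul_smul,
          hE, hE', hEE]
        module
      map_zero' := by rw [map_zero, coeff_zero]; simp
      map_add' := by intro f g; rw [map_add, coeff_add]; module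
      commutes' := by
        intro c
        rw [AlgHom.commutes, Algebra.algebraMap_eq_smul_one (A := PathAlgebra K V), coeff_smul,
          coeff_one _ (by simp)]; simp }
  have hσ (f i j) : σ f i j = ρ f i j +
      if i = Fin.last _ ∧ j = 0 then k * coeff f α.toPath else 0 := by
    change ρ f i j + (k * coeff f α.toPath) * E i j = _
    rw [hE_apply]; simp
  refine ⟨σ, ⟨?_, ?_, ?_⟩, hσ⟩
  · intro f hf
    have : coeff f α.toPath = 0 := by
      by_contra h'
      have := hI.2 f hf _ _ _ h'
      simp at this
    change ρ f + (k * coeff f α.toPath) • E = 0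
    rw [this, h.ann f hf]; simp
  · intro c d β i j hij
    rw [hσ, h.tri _ _ _ _ _ hij, zero_add, if_neg]
    rintro ⟨rfl, rfl⟩
    exact hne (le_antisymm (Fin.zero_le _) hij)
  · intro c r s hp i
    -- An initial subpath of `p` is never `α`, so its effect on `x₀` is unchanged.
    have : coeff (ofPath K r) α.toPath = 0 := by
      rw [coeff_ofPath, if_neg]
      intro e
      injection e with _ e
      injection e with e₁ e₂
      subst e₁
      exact hstart ⟨s, eq_of_heq e₂ ▸ hp⟩
    rw [hσ, h.pre c r s hp, this]
    simp

end IsMastRep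

end PathAlgebra

/-! ### The uniserial module of a representation -/

namespace PathAlgebra

variable {K : Type w} [Field K] {V : Type u} [Quiver.{v} V] [Fintype V]

namespace IsMastRep

variable {I : Ideal (PathAlgebra K V)} [I.IsTwoSided] {a b : V} {p : Path a b}
  {ρ : PathAlgebra K V →ₐ[K] Matrix (Fin (p.length + 1)) (Fin (p.length + 1)) K}

/-- The action of `KΓ / I` on the space of column vectors. -/
noncomputable def toEnd (h : IsMastRep I p ρ) :
    (PathAlgebra K V ⧸ I) →+* Module.End K (Fin (p.length + 1) → K) :=
  (Matrix.toLinAlgEquiv' :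
      Matrix (Fin (p.length + 1)) (Fin (p.length + 1)) K ≃ₐ[K] _).toRingEquiv.toRingHom.comp
    (Ideal.Quotient.lift I ρ.toRingHom h.ann)

/-- The `KΓ / I`-module of column vectors. -/
noncomputable abbrev module (h : IsMastRep I p ρ) :
    Module (PathAlgebra K V ⧸ I) (Fin (p.length + 1) → K) :=
  Module.compHom _ h.toEnd

/-- The `KΓ / I`-module of column vectors, as an object of the module category. -/
noncomputable def moduleCat (h : IsMastRep I p ρ) : ModuleCat.{w} (PathAlgebra K V ⧸ I) :=
  letI := h.module
  ModuleCat.of _ (Fin (p.length + 1) → K)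

theorem mk_smul (h : IsMastRep I p ρ) (f : PathAlgebra K V) (u : Fin (p.length + 1) → K) :
    (letI := h.module; Ideal.Quotient.mk I f • u) = (ρ f).mulVec u := rfl

/-- The submodule of vectors whose coordinates of index less than `i` vanish. -/
def filtration (h : IsMastRep I p ρ) (i : ℕ) :
    letI := h.module
    Submodule (PathAlgebra K V ⧸ I) (Fin (p.length + 1) → K) :=
  letI := h.module
  { carrier := {u | ∀ j : Fin (p.length + 1), (j : ℕ) < i → u j = 0}
    add_mem' := fun hu hv j hj => by rw [Pi.add_apply, hu j hj, hv j hj, add_zero]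
    zero_mem' := fun _ _ => rfl
    smul_mem' := by
      intro f u hu j hj
      obtain ⟨f, rfl⟩ := Ideal.Quotient.mk_surjective f
      rw [h.mk_smul, Matrix.mulVec, dotProduct]
      refine Finset.sum_eq_zero fun k _ => ?_
      by_cases hk : (k : ℕ) < i
      · rw [hu k hk, mul_zero]
      · rw [h.apply_of_lt f j k (Fin.lt_def.2 (by omega)), zero_mul] }

theorem filtration_zero (h : IsMastRep I p ρ) : h.filtration 0 = ⊤ :=
  letI := h.module
  eq_top_iff.2 fun _ _ _ hj => absurd hj (Nat.not_lt_zero _)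

theorem filtration_last (h : IsMastRep I p ρ) : h.filtration (p.length + 1) = ⊥ :=
  letI := h.module
  eq_bot_iff.2 fun _ hu => funext fun j => hu j j.2

theorem filtration_antitone (h : IsMastRep I p ρ) :
    letI := h.module
    Antitone h.filtration :=
  fun _ _ hij _ hu k hk => hu k (hk.trans_le hij)

/-- Subpaths of `p` transport the leading coordinate of a vector; the other coordinates land
strictly deeper. -/
theorem path_mulVec_apply (h : IsMastRep I p ρ) {c d : V} (r : Path a c) (t : Path c d)
    (s : Path d b) (hp : p = (r.comp t).comp s) (u : Fin (p.length + 1) → K)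
    (hu : u ∈ h.filtration r.length) (i j : Fin (p.length + 1)) (hj : (j : ℕ) = r.length)
    (hi : (i : ℕ) ≤ j + t.length) :
    (ρ (ofPath K t)).mulVec u i = if (i : ℕ) = j + t.length then u j else 0 := by
  rw [Matrix.mulVec, dotProduct, Finset.sum_eq_single j]
  · rw [h.subpath_apply r t s hp i j hj, ite_mul, one_mul, zero_mul]
  · intro k _ hk
    by_cases hk' : (k : ℕ) < r.length
    · rw [hu k hk', mul_zero]
    · rw [h.path_apply, zero_mul]
      have : (k : ℕ) ≠ j := fun h' => hk (Fin.ext h')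
      omega
  · simp

theorem self_mulVec_apply (h : IsMastRep I p ρ) (z : Fin (p.length + 1) → K)
    (i : Fin (p.length + 1)) :
    (ρ (ofPath K p)).mulVec z i = if i = Fin.last _ then z 0 else 0 := by
  rw [h.path_mulVec_apply Path.nil p Path.nil (by simp) z (fun j hj => by simp at hj) i 0 rfl
    (by simpa using Nat.lt_succ_iff.1 i.2)]
  simp [Fin.ext_iff]

/-- Take the deepest step containing `N`; some `z` in `N` has a nonzero coordinate there. Subpaths
of `p` move this leading term to every later position, so `N` contains the whole step. -/
theorem exists_eq_filtration (h : IsMastRep I p ρ)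
    (N : letI := h.module; Submodule (PathAlgebra K V ⧸ I) (Fin (p.length + 1) → K)) :
    ∃ i ≤ p.length + 1, N = h.filtration i := by
  let := h.module
  classical
  let i := Nat.findGreatest (fun i => N ≤ h.filtration i) (p.length + 1)
  have hi : N ≤ h.filtration i :=
    Nat.findGreatest_spec (P := fun i => N ≤ h.filtration i) (Nat.zero_le _)
      (h.filtration_zero ▸ le_top)
  have hle : i ≤ p.length + 1 := Nat.findGreatest_le _
  refine ⟨i, hle, le_antisymm hi ?_⟩
  rcases hle.eq_or_lt with hlt | hlt
  · rw [hlt, h.filtration_last]; exact bot_le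
  have hnot : ¬ N ≤ h.filtration (i + 1) :=
    Nat.findGreatest_is_greatest (P := fun i => N ≤ h.filtration i) (Nat.lt_succ_self i) hlt
  obtain ⟨z, hz, hz'⟩ := SetLike.not_le_iff_exists.1 hnot
  have hzi : z ⟨i, hlt⟩ ≠ 0 := by
    intro h0
    refine hz' fun j hj => ?_
    rcases Nat.lt_succ_iff_lt_or_eq.1 hj with hj | hj
    · exact hi hz j hj
    · rw [show j = ⟨i, hlt⟩ from Fin.ext hj, h0]
  obtain ⟨c, r, s, hp, hr⟩ := p.exists_eq_comp_of_le_length (Nat.lt_succ_iff.1 hlt)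
  have hN : ∀ k ≤ p.length + 1 - i, h.filtration (p.length + 1 - k) ≤ N := by
    intro k
    induction k with
    | zero => intro _; rw [Nat.sub_zero, h.filtration_last]; exact bot_le
    | succ k ih =>
      intro hk u hu
      have hs : s.length = p.length - i := by
        have := congrArg Path.length hp
        rw [Path.length_comp] at this; omega
      obtain ⟨d, t, s', hs', ht⟩ :=
        s.exists_eq_comp_of_le_length (n := p.length - k - i) (by omega)
      let j : Fin (p.length + 1) := ⟨p.length - k, by omega⟩
      -- Scaled to cancel the leading coordinate of `u`, so that `u - y` lies one step deeper.
      let y := (u j / z ⟨i, hlt⟩) • (ρ (ofPath K t)).mulVec z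
      have hy : y ∈ N := by
        have : y = Ideal.Quotient.mk I ((u j / z ⟨i, hlt⟩) • ofPath K t) • z := by
          rw [h.mk_smul, map_smul, Matrix.smul_mulVec]
        rw [this]
        exact N.smul_mem _ hz
      have hd : u - y ∈ h.filtration (p.length + 1 - k) := by
        intro m hm
        have := h.path_mulVec_apply r t s' (by rw [hp, hs', Path.comp_assoc]) z (hr ▸ hi hz) m
          ⟨i, hlt⟩ hr.symm (by simp only; omega)
        change u m - (u j / z ⟨i, hlt⟩) • (ρ (ofPath K t)).mulVec z m = 0
        rw [this]
        simp only
        split_ifs with hm'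
        · rw [smul_eq_mul, div_mul_cancel₀ _ hzi, show m = j from Fin.ext (by simp [j]; omega),
            sub_self]
        · rw [hu m (by omega), smul_zero, sub_zero]
      exact (sub_add_cancel u y) ▸ N.add_mem (ih (by omega) hd) hy
  have := hN (p.length + 1 - i) le_rfl
  rwa [Nat.sub_sub_self hle] at this

theorem filtration_covBy (h : IsMastRep I p ρ) (i : ℕ) (hi : i ≤ p.length) :
    letI := h.module
    h.filtration (i + 1) ⋖ h.filtration i := by
  let := h.module
  constructor
  · refine lt_of_le_not_ge (h.filtration_antitone (Nat.le_succ i)) fun hle => ?_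
    have : (Pi.single ⟨i, Nat.lt_succ_of_le hi⟩ 1 : Fin (p.length + 1) → K) ∈ h.filtration i := by
      intro j hj
      rw [Pi.single_eq_of_ne]
      rintro rfl
      exact lt_irrefl _ hj
    have := hle this ⟨i, Nat.lt_succ_of_le hi⟩ (Nat.lt_succ_self i)
    simp at this
  · intro N h1 h2
    obtain ⟨k, -, rfl⟩ := h.exists_eq_filtration N
    rcases Nat.lt_or_ge i k with hk | hk
    · exact h1.not_ge (h.filtration_antitone hk)
    · exact h2.not_ge (h.filtration_antitone hk)

theorem isMast (h : IsMastRep I p ρ) : IsMast I p h.moduleCat := by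
  let := h.module
  refine ⟨?_, ?_, ?_⟩
  · intro M N
    obtain ⟨i, -, hM⟩ := h.exists_eq_filtration M
    obtain ⟨j, -, hN⟩ := h.exists_eq_filtration N
    rcases le_total i j with hij | hij
    · exact .inr (hM ▸ hN ▸ h.filtration_antitone hij)
    · exact .inl (hM ▸ hN ▸ h.filtration_antitone hij)
  · let s : CompositionSeries (Submodule (PathAlgebra K V ⧸ I) (Fin (p.length + 1) → K)) :=
      { length := p.length + 1
        toFun := fun i => h.filtration (p.length + 1 - i)
        step := by
          intro i
          have := h.filtration_covBy (p.length - i) (Nat.sub_le _ _)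
          have e : p.length - i + 1 = p.length + 1 - i := by omega
          rw [e] at this
          change _ ⋖ _
          simpa using this }
    have hs := Module.length_compositionSeries s
      (by change h.filtration (p.length + 1 - 0) = ⊥; exact h.filtration_last)
      (by
        change h.filtration (p.length + 1 - (p.length + 1)) = ⊤
        rw [Nat.sub_self]; exact h.filtration_zero)
    exact hs.symm.trans (by simp [s])
  · refine ⟨(Pi.single 0 1 : Fin (p.length + 1) → K), fun h0 => ?_⟩
    have h1 : (ρ (ofPath K p)).mulVec (Pi.single 0 1) (Fin.last _) = 0 := congrFun h0 _
    rw [Matrix.mulVec_single_one, Matrix.col_apply, h.pre b p Path.nil rfl] at h1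
    simp at h1

/-- In a vector on which `α` acts as `d` times `p`, the scalar `d` is the last coordinate of the
image of `x₀` under `α`, provided that every later passage of `p` through the initial vertex of
`α` continues with `α`. -/
theorem eq_apply_last_of_mulVec_eq (h : IsMastRep I p ρ) (hlen : 0 < p.length) (α : a ⟶ b)
    (hend : ¬ ∃ p' : Path a a, p = p'.comp α.toPath)
    (hmin : ∀ (r : Path a a) (s : Path a b), p = r.comp s → 0 < r.length → 0 < s.length →
      ∃ s' : Path b b, s = α.toPath.comp s')
    (z : Fin (p.length + 1) → K) (hz : (ρ (ofPath K (Path.nil : Path a a))).mulVec z = z)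
    (d : K) (hd : (ρ (ofPath K α.toPath)).mulVec z = d • (ρ (ofPath K p)).mulVec z)
    (hp : (ρ (ofPath K p)).mulVec z ≠ 0) : d = ρ (ofPath K α.toPath) (Fin.last _) 0 := by
  have hz0 : z 0 ≠ 0 := by
    intro h0
    refine hp (funext fun i => ?_)
    rw [h.self_mulVec_apply, h0, ite_self]; rfl
  have key : (ρ (ofPath K α.toPath)).mulVec z (Fin.last _) =
      ρ (ofPath K α.toPath) (Fin.last _) 0 * z 0 := by
    rw [Matrix.mulVec, dotProduct, Finset.sum_eq_single 0]
    · intro j _ hj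
      by_cases hzj : z j = 0
      · rw [hzj, mul_zero]
      rcases (Fin.le_last j).eq_or_lt with rfl | hlt
      · rw [h.tri _ _ _ _ _ le_rfl, zero_mul]
      obtain ⟨c, r, s, hrs, hr⟩ := p.exists_eq_comp_of_le_length (Nat.lt_succ_iff.1 j.2)
      have hj0 : 0 < (j : ℕ) := Nat.pos_of_ne_zero fun h' => hj (Fin.ext h')
      have hc : c = a := by
        by_contra hc
        exact hzj (h.apply_eq_zero_of_nil_mulVec_eq r s hrs hc z hz j hr.symm)
      subst hc
      have hs : p.length = r.length + s.length := by
        conv_lhs => rw [hrs]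
        exact Path.length_comp _ _
      have hjl : (j : ℕ) < p.length := hlt
      -- Here `α` sends `xⱼ` to the next basis vector, which is the last one only if `p` ends in
      -- `α`.
      obtain ⟨s', rfl⟩ := hmin r s hrs (by omega) (by omega)
      rw [h.subpath_apply r α.toPath s' (by rw [hrs, Path.comp_assoc]) _ j hr.symm, if_neg,
        zero_mul]
      intro hl
      simp only [Path.length_comp, Path.length_toPath, Fin.val_last] at hs hl
      have hs' : s'.length = 0 := by omega
      cases s' with
      | nil => exact hend ⟨r, hrs⟩
      | cons => simp at hs'
    · simp
  rw [hd, Pi.smul_apply, h.self_mulVec_apply, if_pos rfl, smul_eq_mul] at key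
  exact mul_right_cancel₀ hz0 key

end IsMastRep

end PathAlgebra

/-! ### From a uniserial module back to matrices -/

namespace PathAlgebra

variable {K : Type w} [Field K] {V : Type u} [Quiver.{v} V]

/-- The subspace spanned by the paths of length at least `k`. -/
noncomputable def pathFiltration (K : Type w) [Field K] (V : Type u) [Quiver.{v} V] (k : ℕ) :
    Submodule K (PathAlgebra K V) :=
  Submodule.span K {f | ∃ (a b : V) (p : Path a b), k ≤ p.length ∧ ofPath K p = f}

theorem ofPath_mem_pathFiltration {a b : V} (p : Path a b) {k : ℕ} (h : k ≤ p.length) :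
    ofPath K p ∈ pathFiltration K V k :=
  Submodule.subset_span ⟨a, b, p, h, rfl⟩

theorem ofPath_comp_of_length_eq_zero {a b c : V} (r : Path a b) (q : Path b c)
    (hq : q.length = 0) : ofPath K (r.comp q) = ofPath K r := by
  cases q with
  | nil => rfl
  | cons => simp at hq

theorem mem_pathFiltration_zero (f : PathAlgebra K V) : f ∈ pathFiltration K V 0 := by
  induction f using induction_on with
  | h0 => exact zero_mem _
  | hadd f g hf hg => exact add_mem hf hg
  | hpath c a b p => exact Submodule.smul_mem _ _ (ofPath_mem_pathFiltration p (Nat.zero_le _))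

variable [Fintype V]

theorem mul_mem_pathFiltration {k l : ℕ} {f g : PathAlgebra K V} (hf : f ∈ pathFiltration K V k)
    (hg : g ∈ pathFiltration K V l) : f * g ∈ pathFiltration K V (k + l) := by
  induction hf using Submodule.span_induction with
  | zero => rw [zero_mul]; exact zero_mem _
  | add f f' _ _ h h' => rw [add_mul]; exact add_mem h h'
  | smul c f _ h =>
    rw [show c • f * g = c • (f * g) from smulmul _ _ _]; exact Submodule.smul_mem _ _ h
  | mem f hf =>
    obtain ⟨a, b, q, hq, rfl⟩ := hf
    induction hg using Submodule.span_induction with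
    | zero => rw [mul_zero]; exact zero_mem _
    | add f f' _ _ h h' => rw [mul_add]; exact add_mem h h'
    | smul c f _ h =>
      rw [show ofPath K q * c • f = c • (ofPath K q * f) from mulsmul _ _ _]
      exact Submodule.smul_mem _ _ h
    | mem g hg =>
      obtain ⟨c, d, r, hr, rfl⟩ := hg
      by_cases h : d = a
      · subst h
        rw [ofPath_mul_ofPath]
        exact ofPath_mem_pathFiltration _ (by rw [Path.length_comp]; omega)
      · rw [ofPath_mul_ofPath_of_ne _ _ h]; exact zero_mem _

theorem pow_mem_pathFiltration {f : PathAlgebra K V} (hf : f ∈ pathFiltration K V 1) (k : ℕ) :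
    f ^ k ∈ pathFiltration K V k := by
  induction k with
  | zero => exact mem_pathFiltration_zero _
  | succ k ih => rw [pow_succ]; exact mul_mem_pathFiltration ih hf

theorem IsAdmissible.exists_pathFiltration_le {I : Ideal (PathAlgebra K V)} (hI : IsAdmissible I) :
    ∃ N, ∀ f ∈ pathFiltration K V N, f ∈ I := by
  obtain ⟨⟨N, -, hN⟩, -⟩ := hI
  refine ⟨N, fun f hf => ?_⟩
  induction hf using Submodule.span_induction with
  | zero => exact zero_mem _
  | add f f' _ _ h h' => exact add_mem h h'
  | smul c f _ h =>
    rw [← one_mul f, ← show c • (1 : PathAlgebra K V) * f = c • (1 * f) from smulmul _ _ _]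
    exact I.mul_mem_left _ h
  | mem f hf =>
    obtain ⟨a, b, q, hq, rfl⟩ := hf
    exact hN a b q hq

/-- On a vector fixed by the trivial path at `c`, each `f` therefore acts as a scalar modulo the
arrow ideal. -/
theorem mul_nil_sub_mem_pathFiltration (f : PathAlgebra K V) (c : V) :
    f * ofPath K (Path.nil : Path c c) - coeff f (Path.nil : Path c c) • ofPath K (Path.nil : Path c c) ∈
      pathFiltration K V 1 := by
  induction f using induction_on with
  | h0 => rw [zero_mul, coeff_zero, zero_smul, sub_zero]; exact zero_mem _
  | hadd f g hf hg =>
    rw [add_mul, coeff_add, add_smul, add_sub_add_comm]; exact add_mem hf hg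
  | hpath d a b p =>
    rw [show d • ofPath K p * ofPath K (Path.nil : Path c c) = d • (ofPath K p * ofPath K Path.nil)
      from smulmul _ _ _, coeff_smul, mul_smul, ← smul_sub]
    refine Submodule.smul_mem _ _ ?_
    by_cases h : c = a
    · subst h
      rw [ofPath_mul_ofPath, Path.nil_comp]
      cases p with
      | nil => rw [coeff_ofPath_self, one_smul, sub_self]; exact zero_mem _
      | cons p β =>
        rw [coeff_ofPath_of_length_ne _ _ (by simp), zero_smul, sub_zero]
        exact ofPath_mem_pathFiltration _ (by simp)
    · rw [ofPath_mul_ofPath_of_ne _ _ h, coeff_ofPath, if_neg, zero_smul, sub_zero]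
      · exact zero_mem _
      · intro e; cases e; exact h rfl

section Radical

variable (I : Ideal (PathAlgebra K V)) [I.IsTwoSided] {U : Type x} [AddCommGroup U]
  [Module (PathAlgebra K V ⧸ I) U]

/-- The submodule of all multiples of `y` by elements of the arrow ideal. -/
def arrowSpan (y : U) : Submodule (PathAlgebra K V ⧸ I) U where
  carrier := {u | ∃ g ∈ pathFiltration K V 1, Ideal.Quotient.mk I g • y = u}
  add_mem' := by
    rintro _ _ ⟨g, hg, rfl⟩ ⟨g', hg', rfl⟩
    exact ⟨g + g', add_mem hg hg', by rw [map_add, add_smul]⟩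
  zero_mem' := ⟨0, zero_mem _, by rw [map_zero, zero_smul]⟩
  smul_mem' := by
    rintro f _ ⟨g, hg, rfl⟩
    obtain ⟨f, rfl⟩ := Ideal.Quotient.mk_surjective f
    refine ⟨f * g, ?_, by rw [map_mul, mul_smul]⟩
    simpa using mul_mem_pathFiltration (mem_pathFiltration_zero f) hg

variable {I}

/-- Nakayama's argument: `y = g y` gives `y = g ^ N y`, and `g ^ N` lies in `I` for large `N`. -/
theorem notMem_arrowSpan (hI : IsAdmissible I) {y : U} (hy : y ≠ 0) : y ∉ arrowSpan I y := by
  rintro ⟨g, hg, h⟩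
  obtain ⟨N, hN⟩ := hI.exists_pathFiltration_le
  have hk (k : ℕ) : Ideal.Quotient.mk I (g ^ k) • y = y := by
    induction k with
    | zero => rw [pow_zero, map_one, one_smul]
    | succ k ih => rw [pow_succ, map_mul, mul_smul, h, ih]
  refine hy ?_
  rw [← hk N, Ideal.Quotient.eq_zero_iff_mem.2 (hN _ (pow_mem_pathFiltration hg N)), zero_smul]

theorem arrowSpan_lt_span (hI : IsAdmissible I) {y : U} (hy : y ≠ 0) :
    arrowSpan I y < Submodule.span _ {y} := by
  refine lt_of_le_of_ne ?_ fun h => notMem_arrowSpan hI hy (h ▸ Submodule.mem_span_singleton_self y)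
  rintro _ ⟨g, -, rfl⟩
  exact Submodule.smul_mem _ _ (Submodule.mem_span_singleton_self y)

end Radical

/-- In a module of finite length `m`, a chain `N 0, …, N m` of strictly decreasing submodules is
a composition series. -/
theorem eq_top_and_eq_of_chain {R : Type*} [Ring R] {U : Type*} [AddCommGroup U] [Module R U]
    (n : ℕ) (hU : Module.length R U = n + 1) (N T : ℕ → Submodule R U)
    (h1 : ∀ i ≤ n, N (i + 1) ≤ T i) (h2 : ∀ i ≤ n, T i < N i) :
    N 0 = ⊤ ∧ ∀ i ≤ n, N (i + 1) = T i := by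
  -- All heights are finite here, so `toNat` loses nothing. Counting from the bottom and from the
  -- top pins the height of each `N i`, leaving no room for a further strict inclusion.
  let ht : Submodule R U → ℕ := fun X => (Order.height X).toNat
  rw [Module.length_eq_height] at hU
  have hfin (X : Submodule R U) : Order.height X < ⊤ :=
    (Order.height_mono le_top).trans_lt (hU ▸ ENat.natCast_lt_top (n + 1))
  have hmono {X Y : Submodule R U} (h : X < Y) : ht X < ht Y := by
    have := Order.height_strictMono h (hfin X)
    rw [← ENat.natCast_toNat (hfin X).ne, ← ENat.natCast_toNat (hfin Y).ne] at this
    exact_mod_cast this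
  have htop : ht ⊤ = n + 1 := by
    simp only [ht, hU]; rfl
  have hstep (i) (hi : i ≤ n) : ht (N (i + 1)) < ht (N i) := hmono ((h1 i hi).trans_lt (h2 i hi))
  have hlow (k) (hk : k ≤ n + 1) : k ≤ ht (N (n + 1 - k)) := by
    induction k with
    | zero => exact Nat.zero_le _
    | succ k ih =>
      have h3 := hstep (n + 1 - (k + 1)) (by omega)
      rw [show n + 1 - (k + 1) + 1 = n + 1 - k by omega] at h3
      have := ih (by omega)
      omega
  have hup (i) (hi : i ≤ n + 1) : ht (N i) + i ≤ n + 1 := by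
    induction i with
    | zero =>
      rcases (le_top : N 0 ≤ ⊤).eq_or_lt with h | h
      · rw [h, htop]
      · have := hmono h; omega
    | succ i ih =>
      have h3 := hstep i (by omega)
      have := ih (by omega)
      omega
  constructor
  · refine le_top.eq_or_lt.resolve_right fun h => ?_
    have h3 := hmono h
    have h4 := hlow (n + 1) le_rfl
    rw [Nat.sub_self] at h4
    omega
  · intro i hi
    refine (h1 i hi).eq_or_lt.resolve_right fun h => ?_
    have h3 := hmono h
    have h4 := hmono (h2 i hi)
    have h5 := hup i (by omega)
    have h6 := hlow (n + 1 - (i + 1)) (by omega)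
    rw [show n + 1 - (n + 1 - (i + 1)) = i + 1 by omega] at h6
    omega

/-- The cyclic submodules of the `X i` descend strictly, by Nakayama's argument. The length `n + 1`
forces the submodule generated by `X (i + 1)` to be all arrow multiples of `X i`, so each layer is a
line over `K` and the `X i` form a basis. The last clause carries relations on `y` over to the
zeroth column. -/
theorem IsMast.exists_isMastRep_of_isScalarTower {I : Ideal (PathAlgebra K V)} [I.IsTwoSided]
    (hI : IsAdmissible I) {a b : V} {p : Path a b} {U : Type x} [AddCommGroup U]
    [Module (PathAlgebra K V ⧸ I) U] [Module K U] [IsScalarTower K (PathAlgebra K V ⧸ I) U]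
    (h : IsMast I p U) (y : U) (hy : Ideal.Quotient.mk I (ofPath K (Path.nil : Path a a)) • y = y)
    (hpy : Ideal.Quotient.mk I (ofPath K p) • y ≠ 0) :
    ∃ ρ, IsMastRep I p ρ ∧
      ∀ f, Ideal.Quotient.mk I f • y = 0 → ∀ i, ρ f i 0 = 0 := by
  choose c r s hp hr using fun i (hi : i ≤ p.length) => p.exists_eq_comp_of_le_length hi
  -- The value `0` beyond the end of `p` lets the chain stop at the zero submodule.
  let X : ℕ → U := fun i =>
    if hi : i ≤ p.length then Ideal.Quotient.mk I (ofPath K (r i hi)) • y else 0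
  have hX {d : V} (t : Path a d) (t' : Path d b) (ht : p = t.comp t') :
      X t.length = Ideal.Quotient.mk I (ofPath K t) • y := by
    have hi : t.length ≤ p.length := by rw [ht, Path.length_comp]; omega
    simp only [X, dif_pos hi]
    obtain ⟨q, h1, h2⟩ := Path.exists_comp_of_comp_eq_comp (r _ hi) t (s _ hi) t'
      ((hp _ hi).symm.trans ht) (hr _ hi).le
    have hq := congrArg Path.length h1
    rw [Path.length_comp, hr] at hq
    have e : ofPath K t = ofPath K (r _ hi) :=
      (congrArg (ofPath K) h1).trans (ofPath_comp_of_length_eq_zero _ q (by omega))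
    rw [e]
  have hX0 : X 0 = y := (hX Path.nil p (by simp)).trans hy
  have hXne (i) (hi : i ≤ p.length) : X i ≠ 0 := by
    intro h0
    refine hpy ?_
    have : ofPath K p = ofPath K (s i hi) * ofPath K (r i hi) := by
      rw [ofPath_mul_ofPath, ← hp]
    rw [this, map_mul, mul_smul, ← hX _ _ (hp i hi), hr, h0, smul_zero]
  have hXnil (i) (hi : i ≤ p.length) :
      Ideal.Quotient.mk I (ofPath K (Path.nil : Path (c i hi) (c i hi))) • X i = X i := by
    have := hX _ _ (hp i hi)
    rw [hr] at this
    rw [this, ← mul_smul, ← map_mul, ofPath_mul_ofPath, Path.comp_nil]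
  have hXsucc (i) (hi : i ≤ p.length) : X (i + 1) ∈ arrowSpan I (X i) := by
    by_cases hi' : i + 1 ≤ p.length
    · obtain ⟨q, h1, h2⟩ := Path.exists_comp_of_comp_eq_comp (r _ hi) (r _ hi') (s _ hi) (s _ hi')
        ((hp _ hi).symm.trans (hp _ hi')) (by rw [hr, hr]; omega)
      have hq := congrArg Path.length h1
      rw [Path.length_comp, hr, hr] at hq
      refine ⟨ofPath K q, ofPath_mem_pathFiltration q (by omega), ?_⟩
      have e1 := hX _ _ (hp i hi)
      have e2 := hX _ _ (hp _ hi')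
      rw [hr] at e1 e2
      rw [e1, e2, ← mul_smul, ← map_mul, ofPath_mul_ofPath, ← h1]
    · simp only [X, dif_neg hi']
      exact zero_mem _
  obtain ⟨htop, hN⟩ := eq_top_and_eq_of_chain p.length h.2.1
    (fun i => Submodule.span (PathAlgebra K V ⧸ I) {X i}) (fun i => arrowSpan I (X i))
    (fun i hi => Submodule.span_le.2 (Set.singleton_subset_iff.2 (hXsucc i hi)))
    (fun i hi => arrowSpan_lt_span hI (hXne i hi))
  let X' : Fin (p.length + 1) → U := fun i => X i
  have hsmul (d : K) (u : U) : d • u = Ideal.Quotient.mk I (d • 1) • u := by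
    rw [← Ideal.Quotient.mkₐ_eq_mk K, map_smul, map_one, smul_assoc, one_smul]
  have hspan_le (i j) (hi : i ≤ j) (hj : j ≤ p.length + 1) :
      Submodule.span (PathAlgebra K V ⧸ I) {X j} ≤
        Submodule.span (PathAlgebra K V ⧸ I) {X i} := by
    induction j, hi using Nat.le_induction with
    | base => exact le_rfl
    | succ j hij ih =>
      refine le_trans ?_ (ih (by omega))
      exact (hN j (by omega)).le.trans (arrowSpan_lt_span hI (hXne j (by omega))).le
  have hspan (k) (hk : k ≤ p.length + 1) :
      ∀ u ∈ Submodule.span (PathAlgebra K V ⧸ I) {X (p.length + 1 - k)},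
        u ∈ Submodule.span K (X' '' {j | p.length + 1 - k ≤ (j : ℕ)}) := by
    induction k with
    | zero =>
      intro u hu
      have : X (p.length + 1) = 0 := dif_neg (by omega)
      rw [Nat.sub_zero, this, Submodule.span_zero_singleton, Submodule.mem_bot] at hu
      rw [hu]; exact zero_mem _
    | succ k ih =>
      intro u hu
      obtain ⟨f, rfl⟩ := Submodule.mem_span_singleton.1 hu
      obtain ⟨f, rfl⟩ := Ideal.Quotient.mk_surjective f
      have hi : p.length + 1 - (k + 1) ≤ p.length := by omega
      set i := p.length + 1 - (k + 1) with hi_def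
      have hi' : i + 1 = p.length + 1 - k := by omega
      -- Split off the scalar by which `f` acts on the layer; the rest lies in the next submodule.
      have e : Ideal.Quotient.mk I f • X i =
          coeff f (Path.nil : Path (c i hi) (c i hi)) • X i +
            Ideal.Quotient.mk I (f * ofPath K (Path.nil : Path (c i hi) (c i hi)) -
              coeff f (Path.nil : Path (c i hi) (c i hi)) •
                ofPath K (Path.nil : Path (c i hi) (c i hi))) • X i := by
        rw [map_sub, sub_smul, map_mul, mul_smul, hXnil, ← Ideal.Quotient.mkₐ_eq_mk K, map_smul,
          smul_assoc, Ideal.Quotient.mkₐ_eq_mk K, hXnil]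
        abel
      rw [e]
      refine add_mem (Submodule.smul_mem _ _ (Submodule.subset_span
        ⟨⟨i, by omega⟩, le_refl i, rfl⟩)) ?_
      have hmem := ih (by omega) (Ideal.Quotient.mk I
          (f * ofPath K (Path.nil : Path (c i hi) (c i hi)) -
              coeff f (Path.nil : Path (c i hi) (c i hi)) •
                ofPath K (Path.nil : Path (c i hi) (c i hi))) • X i) (by
        rw [← hi', hN i hi]
        exact ⟨_, mul_nil_sub_mem_pathFiltration f _, rfl⟩)
      refine Submodule.span_mono (Set.image_mono fun j hj => ?_) hmem
      simp only [Set.mem_ofPred_eq] at hj ⊢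
      omega
  have hli : LinearIndependent K X' := by
    rw [Fintype.linearIndependent_iff]
    intro g hg
    by_contra! hne
    obtain ⟨i₀, hi₀⟩ := hne
    classical
    -- The first vector in a nontrivial relation would lie in the submodule generated by its
    -- successor, hence among its own arrow multiples.
    obtain ⟨i, hi, hmin⟩ : ∃ i, g i ≠ 0 ∧ ∀ j < i, g j = 0 := by
      obtain ⟨i, hi, hmin⟩ := WellFounded.has_min (wellFounded_lt (α := Fin (p.length + 1)))
        {i | g i ≠ 0} ⟨i₀, hi₀⟩
      exact ⟨i, hi, fun j hj => by_contra fun h' => hmin j h' hj⟩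
    refine notMem_arrowSpan hI (hXne i (Nat.lt_succ_iff.1 i.2)) ?_
    have hN' := hN i (Nat.lt_succ_iff.1 i.2)
    rw [← hN']
    rw [← Finset.add_sum_erase _ _ (Finset.mem_univ i)] at hg
    have hmem : ∑ j ∈ Finset.univ.erase i, g j • X' j ∈
        Submodule.span (PathAlgebra K V ⧸ I) {X (i + 1)} := by
      refine Submodule.sum_mem _ fun j hj => ?_
      rcases lt_or_gt_of_ne (Finset.ne_of_mem_erase hj) with hji | hji
      · rw [hmin j hji, zero_smul]; exact zero_mem _
      · rw [hsmul]
        refine Submodule.smul_mem _ _ (hspan_le (i + 1) j ?_ j.2.le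
          (Submodule.mem_span_singleton_self _))
        exact hji
    have : X i = Ideal.Quotient.mk I ((-(g i)⁻¹) • 1) •
        ∑ j ∈ Finset.univ.erase i, g j • X' j := by
      rw [← hsmul, eq_neg_of_add_eq_zero_right hg, smul_neg, neg_smul, neg_neg, smul_smul,
        inv_mul_cancel₀ hi, one_smul]
    rw [this]
    exact Submodule.smul_mem _ _ hmem
  have hsp : ⊤ ≤ Submodule.span K (Set.range X') := by
    intro u _
    have := hspan (p.length + 1) le_rfl u (by
      rw [Nat.sub_self]
      rw [htop]
      exact Submodule.mem_top)
    exact Submodule.span_mono (Set.image_subset_range _ _) this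
  let B := Module.Basis.mk hli hsp
  have hB (i) : B i = X i := Module.Basis.mk_apply hli hsp i
  let ρ : PathAlgebra K V →ₐ[K] Matrix (Fin (p.length + 1)) (Fin (p.length + 1)) K :=
    (LinearMap.toMatrixAlgEquiv B).toAlgHom.comp
      ((Algebra.lsmul K K U).comp (Ideal.Quotient.mkₐ K I))
  have hρ (f i j) : ρ f i j = B.repr (Ideal.Quotient.mk I f • X j) i := by
    rw [← hB]
    exact LinearMap.toMatrixAlgEquiv_apply ..
  refine ⟨ρ, ⟨?_, ?_, ?_⟩, ?_⟩
  · intro f hf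
    ext i j
    rw [hρ, Ideal.Quotient.eq_zero_iff_mem.2 hf, zero_smul, map_zero]; rfl
  · intro d₁ d₂ β i j hij
    rw [hρ]
    have hj : (j : ℕ) ≤ p.length := Nat.lt_succ_iff.1 j.2
    have h1 : Ideal.Quotient.mk I (ofPath K β.toPath) • X j ∈
        Submodule.span (PathAlgebra K V ⧸ I) {X (j + 1)} := by
      rw [hN j hj]
      exact ⟨_, ofPath_mem_pathFiltration _ (by simp), rfl⟩
    have h2 := hspan (p.length - j) (by omega)
    rw [show p.length + 1 - (p.length - j) = j + 1 by omega] at h2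
    have h3 := h2 _ h1
    rw [show X' = B from funext fun i => (hB i).symm, Module.Basis.mem_span_image] at h3
    by_contra hne
    have : (j : ℕ) + 1 ≤ i := h3 (Finsupp.mem_support_iff.2 hne)
    have := Fin.le_def.1 hij
    omega
  · intro d t t' ht i
    have hlt : t.length < p.length + 1 := by rw [ht, Path.length_comp]; omega
    rw [hρ]
    have e : Ideal.Quotient.mk I (ofPath K t) • X (0 : Fin (p.length + 1)) =
        B ⟨t.length, hlt⟩ := by
      rw [hB, hX t t' ht, Fin.val_zero, hX0]
    rw [e, B.repr_self, Finsupp.single_apply]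
    simp [Fin.ext_iff, eq_comm]
  · intro f hf i
    rw [hρ, Fin.val_zero, hX0, hf, map_zero]; rfl

theorem IsMast.exists_isMastRep {I : Ideal (PathAlgebra K V)} [I.IsTwoSided]
    (hI : IsAdmissible I) {a b : V} {p : Path a b} {U : Type x} [AddCommGroup U]
    [Module (PathAlgebra K V ⧸ I) U]
    (h : IsMast I p U) (y : U) (hy : Ideal.Quotient.mk I (ofPath K (Path.nil : Path a a)) • y = y)
    (hpy : Ideal.Quotient.mk I (ofPath K p) • y ≠ 0) :
    ∃ ρ, IsMastRep I p ρ ∧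
      ∀ f, Ideal.Quotient.mk I f • y = 0 → ∀ i, ρ f i 0 = 0 := by
  let : Module K U := Module.compHom U (algebraMap K (PathAlgebra K V ⧸ I))
  have : IsScalarTower K (PathAlgebra K V ⧸ I) U :=
    ⟨fun c f u => by rw [Algebra.smul_def, mul_smul]; rfl⟩
  exact h.exists_isMastRep_of_isScalarTower hI y hy hpy

end PathAlgebra

/-! ### Normalizing the generator and descending to a minimal subpath -/

namespace PathAlgebra

variable {K : Type w} [Field K] {V : Type u} [Quiver.{v} V] [Fintype V]
  {I : Ideal (PathAlgebra K V)} [I.IsTwoSided]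

namespace IsMastRep

variable {a b : V} {p : Path a b}
  {ρ : PathAlgebra K V →ₐ[K] Matrix (Fin (p.length + 1)) (Fin (p.length + 1)) K}

/-- The generator `x₀` can be changed so that `α` sends it to a multiple of its image under `p`,
provided that every earlier passage of `p` through the final vertex of `α` arrives by `α`. -/
theorem exists_mulVec_eq (h : IsMastRep I p ρ) (hlen : 0 < p.length) (α : a ⟶ b)
    (hstart : ¬ ∃ p' : Path b b, p = α.toPath.comp p')
    (hmin : ∀ (r : Path a b) (s : Path b b), p = r.comp s → 0 < r.length → 0 < s.length →
      ∃ r' : Path a a, r = r'.comp α.toPath) :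
    ∃ (z : Fin (p.length + 1) → K) (d : K),
      (ρ (ofPath K (Path.nil : Path a a))).mulVec z = z ∧ (ρ (ofPath K p)).mulVec z ≠ 0 ∧
        (ρ (ofPath K α.toPath)).mulVec z = d • (ρ (ofPath K p)).mulVec z := by
  -- The coordinates of `α z` before the last are cleared one at a time, keeping `z 0 = 1` so that
  -- `p z` stays nonzero.
  have key (t : ℕ) (ht : t + 1 ≤ p.length) : ∃ z : Fin (p.length + 1) → K, z 0 = 1 ∧
      (ρ (ofPath K (Path.nil : Path a a))).mulVec z = z ∧
        ∀ j : Fin (p.length + 1), (j : ℕ) < t + 1 → (ρ (ofPath K α.toPath)).mulVec z j = 0 := by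
    induction t with
    | zero =>
      refine ⟨Pi.single 0 1, Pi.single_eq_same _ _, ?_, fun j hj => ?_⟩
      · ext i
        rw [Matrix.mulVec_single_one, Matrix.col_apply, h.pre a Path.nil p (by simp)]
        simp [Pi.single_apply]
      · rw [Matrix.mulVec_single_one, Matrix.col_apply, h.tri]
        rw [Fin.le_def, Fin.val_zero]; omega
    | succ t ih =>
      obtain ⟨z, hz0, hz, hα⟩ := ih (by omega)
      let m : Fin (p.length + 1) := ⟨t + 1, by omega⟩
      set w := (ρ (ofPath K α.toPath)).mulVec z with hw
      by_cases hwm : w m = 0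
      · refine ⟨z, hz0, hz, fun j hj => ?_⟩
        rcases Nat.lt_succ_iff_lt_or_eq.1 hj with hj | hj
        · exact hα j hj
        · rw [show j = m from Fin.ext hj]; exact hwm
      have hwb : (ρ (ofPath K (Path.nil : Path b b))).mulVec w = w := by
        rw [hw, Matrix.mulVec_mulVec, ← map_mul, ofPath_mul_ofPath, Path.comp_nil]
      obtain ⟨c, r, s, hrs, hr⟩ := p.exists_eq_comp_of_le_length (n := t + 1) (by omega)
      have hc : c = b := by
        by_contra hc
        exact hwm (h.apply_eq_zero_of_nil_mulVec_eq r s hrs hc w hwb m hr.symm)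
      subst hc
      have hl := congrArg Path.length hrs
      rw [Path.length_comp] at hl
      obtain ⟨r', rfl⟩ := hmin r s hrs (by omega) (by omega)
      have hr' : r'.length = t := by simpa using hr
      have hrs' : p = r'.comp (α.toPath.comp s) := by rw [hrs, Path.comp_assoc]
      have ht0 : t ≠ 0 := by
        rintro rfl
        rw [Path.eq_nil_of_length_zero r' hr', Path.nil_comp] at hrs
        exact hstart ⟨s, hrs⟩
      -- This is the basis vector of index `t`, and `α` maps it exactly to that of index `t + 1`;
      -- since `t ≠ 0`, subtracting a multiple leaves `z 0` alone.
      let y : Fin (p.length + 1) → K := (ρ (ofPath K r')).mulVec (Pi.single 0 1)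
      refine ⟨z - w m • y, ?_, ?_, fun j hj => ?_⟩
      · have : y 0 = 0 := by
          simp only [y]
          rw [Matrix.mulVec_single_one, Matrix.col_apply, h.pre _ _ _ hrs', if_neg]
          rw [Fin.val_zero]; omega
        rw [Pi.sub_apply, Pi.smul_apply, this, hz0, smul_zero, sub_zero]
      · rw [Matrix.mulVec_sub, Matrix.mulVec_smul, hz, Matrix.mulVec_mulVec, ← map_mul,
          ofPath_mul_ofPath, Path.comp_nil]
      · have hy : (ρ (ofPath K α.toPath)).mulVec y j = if (j : ℕ) = t + 1 then 1 else 0 := by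
          rw [Matrix.mulVec_mulVec, ← map_mul, ofPath_mul_ofPath, Matrix.mulVec_single_one,
            Matrix.col_apply, h.pre _ _ _ hrs, hr]
        rw [Matrix.mulVec_sub, Matrix.mulVec_smul, Pi.sub_apply, Pi.smul_apply, hy, ← hw]
        split_ifs with hj'
        · rw [show j = m from Fin.ext hj']; simp
        · rw [hα j (by omega)]; simp
  obtain ⟨z, hz0, hz, hα⟩ := key (p.length - 1) (by omega)
  refine ⟨z, (ρ (ofPath K α.toPath)).mulVec z (Fin.last _), hz, fun h0 => ?_, ?_⟩
  · have := congrFun h0 (Fin.last _)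
    rw [h.self_mulVec_apply, if_pos rfl, hz0] at this
    exact one_ne_zero this
  · ext i
    rw [Pi.smul_apply, h.self_mulVec_apply]
    split_ifs with hi
    · rw [hi, hz0, smul_eq_mul, mul_one]
    · rw [smul_zero]
      refine hα i ?_
      have : (i : ℕ) < p.length := Fin.lt_last_iff_ne_last.2 hi
      omega

/-- The deformations of a normalized representation are pairwise non-isomorphic. -/
theorem exists_nonisomorphic [Infinite K] (h : IsMastRep I p ρ) (hI : IsAdmissible I)
    (hlen : 0 < p.length) (α : a ⟶ b)
    (hstart : ¬ ∃ p' : Path b b, p = α.toPath.comp p')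
    (hend : ¬ ∃ p' : Path a a, p = p'.comp α.toPath)
    (hmin : ∀ (r : Path a a) (s : Path a b), p = r.comp s → 0 < r.length → 0 < s.length →
      ∃ s' : Path b b, s = α.toPath.comp s')
    (d : K) (hd : ∀ i, ρ (ofPath K α.toPath) i 0 = if i = Fin.last _ then d else 0) :
    ∃ W : ℕ → ModuleCat.{w} (PathAlgebra K V ⧸ I),
      (∀ i, IsMast I p (W i)) ∧
      ∀ i j, i ≠ j → ¬ Nonempty (W i ≃ₗ[PathAlgebra K V ⧸ I] W j) := by
  choose σ hσ hσ' using h.exists_deform hI hlen α hstart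
  have hσα (k i) : σ k (ofPath K α.toPath) i 0 = if i = Fin.last _ then d + k else 0 := by
    rw [hσ', hd, coeff_ofPath_self]
    by_cases hi : i = Fin.last _ <;> simp [hi]
  let k := Infinite.natEmbedding K
  refine ⟨fun i => (hσ (k i)).moduleCat, fun i => (hσ (k i)).isMast, ?_⟩
  rintro i j hij ⟨φ⟩
  let e₀ : Fin (p.length + 1) → K := Pi.single 0 1
  let z : Fin (p.length + 1) → K := φ e₀
  have hmul (f g : PathAlgebra K V)
      (hfg : (σ (k i) f).mulVec e₀ = (σ (k i) g).mulVec e₀) :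
      (σ (k j) f).mulVec z = (σ (k j) g).mulVec z := by
    have h1 : φ ((σ (k i) f).mulVec e₀) = (σ (k j) f).mulVec z :=
      φ.map_smul (Ideal.Quotient.mk I f) e₀
    have h2 : φ ((σ (k i) g).mulVec e₀) = (σ (k j) g).mulVec z :=
      φ.map_smul (Ideal.Quotient.mk I g) e₀
    rw [← h1, ← h2, hfg]
  have hp (i') : (σ (k i) (ofPath K p)).mulVec e₀ i' = if i' = Fin.last _ then 1 else 0 := by
    rw [(hσ (k i)).self_mulVec_apply]; simp [e₀]
  have hz : (σ (k j) (ofPath K (Path.nil : Path a a))).mulVec z = z := by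
    rw [hmul _ 1 ?_, map_one, Matrix.one_mulVec]
    ext i'
    rw [map_one, Matrix.one_mulVec, Matrix.mulVec_single_one, Matrix.col_apply,
      (hσ (k i)).pre a Path.nil p (by simp)]
    simp [e₀, Pi.single_apply]
  -- The isomorphism carries the relation with scalar `d + k i` into the other module, where the
  -- scalar can only be `d + k j`.
  have hα : (σ (k j) (ofPath K α.toPath)).mulVec z =
      (d + k i) • (σ (k j) (ofPath K p)).mulVec z := by
    rw [hmul _ ((d + k i) • ofPath K p), map_smul, Matrix.smul_mulVec]
    ext i'
    rw [map_smul, Matrix.smul_mulVec, Pi.smul_apply, hp, Matrix.mulVec_single_one,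
      Matrix.col_apply, hσα]
    simp
  have hpz : (σ (k j) (ofPath K p)).mulVec z ≠ 0 := by
    intro h0
    have h1 : φ ((σ (k i) (ofPath K p)).mulVec e₀) = 0 :=
      (φ.map_smul (Ideal.Quotient.mk I (ofPath K p)) e₀).trans h0
    have h2 := congrFun (φ.map_eq_zero_iff.1 h1) (Fin.last _)
    rw [hp, if_pos rfl] at h2
    exact one_ne_zero h2
  have := (hσ (k j)).eq_apply_last_of_mulVec_eq hlen α hend hmin z hz _ hα hpz
  rw [hσα, if_pos rfl] at this
  exact hij (k.injective (add_left_cancel this))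

theorem exists_subpath_nonisomorphic [Infinite K] (hI : IsAdmissible I) (α : a ⟶ b) (n : ℕ) :
    ∀ (p : Path a b) (ρ : PathAlgebra K V →ₐ[K]
        Matrix (Fin (p.length + 1)) (Fin (p.length + 1)) K),
      p.length = n → IsMastRep I p ρ → 0 < p.length →
      (¬ ∃ p' : Path b b, p = α.toPath.comp p') → (¬ ∃ p' : Path a a, p = p'.comp α.toPath) →
    ∃ (c d : V) (q : Path c d), IsSubpath q p ∧
      ∃ W : ℕ → ModuleCat.{w} (PathAlgebra K V ⧸ I),
        (∀ i, IsMast I q (W i)) ∧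
        ∀ i j, i ≠ j → ¬ Nonempty (W i ≃ₗ[PathAlgebra K V ⧸ I] W j) := by
  induction n using Nat.strong_induction_on with
  | _ n ih =>
  intro p ρ hn h hlen hstart hend
  by_cases hsub : ∃ (q : Path a b) (r : Path a a) (s : Path b b), p = (r.comp q).comp s ∧
      q.length < p.length ∧ 0 < q.length ∧ (¬ ∃ q' : Path b b, q = α.toPath.comp q') ∧
      ¬ ∃ q' : Path a a, q = q'.comp α.toPath
  · obtain ⟨q, r, s, hp, hlt, hpos, hs, he⟩ := hsub
    obtain ⟨σ, hσ⟩ := h.exists_subpath r q s hp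
    obtain ⟨c, d, t, ⟨r', s', ht⟩, hW⟩ := ih _ (hn ▸ hlt) q σ rfl hσ hpos hs he
    refine ⟨c, d, t, ⟨r.comp r', s'.comp s, ?_⟩, hW⟩
    rw [hp, ht]
    simp only [Path.comp_assoc]
  -- The terminal piece `s` inherits from `p` that it does not end in `α`, so by minimality it must
  -- start in `α`; dually for `hmin₂`.
  have hmin₁ (r : Path a a) (s : Path a b) (hp : p = r.comp s) (hr : 0 < r.length)
      (hs : 0 < s.length) : ∃ s' : Path b b, s = α.toPath.comp s' := by
    by_contra hc
    refine hsub ⟨s, r, Path.nil, hp, ?_, hs, hc, ?_⟩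
    · rw [hp, Path.length_comp]; omega
    · rintro ⟨q', rfl⟩
      exact hend ⟨r.comp q', by rw [hp, Path.comp_assoc]⟩
  have hmin₂ (r : Path a b) (s : Path b b) (hp : p = r.comp s) (hr : 0 < r.length)
      (hs : 0 < s.length) : ∃ r' : Path a a, r = r'.comp α.toPath := by
    by_contra hc
    refine hsub ⟨r, Path.nil, s, by rw [Path.nil_comp, hp], ?_, hr, ?_, hc⟩
    · rw [hp, Path.length_comp]; omega
    · rintro ⟨q', rfl⟩
      exact hstart ⟨q'.comp s, by rw [hp, Path.comp_assoc]⟩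
  obtain ⟨z, d, hz, hpz, hα⟩ := h.exists_mulVec_eq hlen α hstart hmin₂
  -- Rebuild the matrices with `z` as generator; `α z = d p z` then prescribes the zeroth column of
  -- `α`.
  obtain ⟨σ, hσ, hσz⟩ := h.isMast.exists_isMastRep hI z hz hpz
  refine ⟨a, b, p, ⟨Path.nil, Path.nil, by simp⟩,
    hσ.exists_nonisomorphic hI hlen α hstart hend hmin₁ d fun i => ?_⟩
  have h1 := hσz (ofPath K α.toPath - d • ofPath K p) (by
    change (ρ (ofPath K α.toPath - d • ofPath K p)).mulVec z = 0
    rw [map_sub, map_smul, Matrix.sub_mulVec, Matrix.smul_mulVec, hα, sub_self]) i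
  rw [map_sub, map_smul, Matrix.sub_apply, Matrix.smul_apply, hσ.pre b p Path.nil rfl,
    sub_eq_zero] at h1
  rw [h1]
  simp [Fin.ext_iff]

end IsMastRep

end PathAlgebra

theorem proposition3p2 {K : Type w} [Field K] [Infinite K]
    {V : Type u} [Quiver.{v} V] [Fintype V] [∀ a b : V, Finite (a ⟶ b)]
    (I : Ideal (PathAlgebra K V)) [I.IsTwoSided] (hI : PathAlgebra.IsAdmissible I)
    {e e' : V} (α : e ⟶ e') (p : Quiver.Path e e') (hlen : 0 < p.length)
    (hmast : ∃ U : ModuleCat.{x} (PathAlgebra K V ⧸ I), PathAlgebra.IsMast I p U)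
    (hstart : ¬ ∃ p' : Quiver.Path e' e', p = α.toPath.comp p')
    (hend : ¬ ∃ p' : Quiver.Path e e, p = p'.comp α.toPath) :
    ∃ (a b : V) (q : Quiver.Path a b), IsSubpath q p ∧
      ∃ W : ℕ → ModuleCat.{w} (PathAlgebra K V ⧸ I),
        (∀ i, PathAlgebra.IsMast I q (W i)) ∧
        ∀ i j, i ≠ j → ¬ Nonempty (W i ≃ₗ[PathAlgebra K V ⧸ I] W j) := by

  obtain ⟨U, hU⟩ := hmast
  obtain ⟨y, hy⟩ := hU.2.2
  -- Projecting `y` to the starting vertex of `p` does not change `p y`.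
  obtain ⟨ρ, hρ, -⟩ := hU.exists_isMastRep hI
    (Ideal.Quotient.mk I (PathAlgebra.ofPath K (Quiver.Path.nil : Quiver.Path e e)) • y)
    (by rw [← mul_smul, ← map_mul, PathAlgebra.ofPath_mul_ofPath, Quiver.Path.comp_nil])
    (by rwa [← mul_smul, ← map_mul, PathAlgebra.ofPath_mul_ofPath, Quiver.Path.nil_comp])
  exact PathAlgebra.IsMastRep.exists_subpath_nonisomorphic hI α p.length p ρ rfl hρ hlen hstart hend
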